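/- Let $(W,S)$ be a Coxeter system, with $W$ partially ordered by the Bruhat order $\le$ and graded by the length function. Write $u\lhd v$ if $u<v$ and no $z$ satisfies $u<z<v$, and let $\mathrm{coat}(v)=\{u : u\lhd v\}$. A partial special matching of $W$ is a pair $(Q,\varphi)$, where $Q\subseteq W$ is down-closed ($x\le q\in Q$ implies $x\in Q$) and $\varphi:Q\to Q$ satisfies, for all $u\in Q$: (i) $\varphi(\varphi(u))=u$; (ii) $u\lhd\varphi(u)$ or $\varphi(u)\lhd u$; (iii) if $u\lhd\varphi(u)$, then $\mathrm{coat}(\varphi(u))=\{u\}\cup\{\varphi(v) : v\lhd u,\ v\lhd\varphi(v)\}$. It is maximal if no partial special matching $(Q',\varphi')$ with $Q\subsetneq Q'$ satisfies $\varphi'|_Q=\varphi$. Let $(Q,\varphi)$ be a maximal partial special matching of $W$, let $a=\varphi(e)$ (an element of $S$), and for $s\in S\setminus\{a\}$ let $P_s=\langle s,a\rangle$ (it is known that $P_s\subseteq Q$ and $\varphi(P_s)=P_s$). Let $X,Y\subseteq S$. (1) Suppose that $\varphi(v)=va$ for all $x\in X\setminus\{a\}$ and $v\in P_x$, and that for every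 $y\in Y\setminus\{a\}$ the restriction $\varphi|_{P_y}$ is left $a$-regular, i.e. $P_y$ is stable under $v\mapsto av$ and $\varphi(av)=a\varphi(v)$ for all $v\in P_y$. Then $\langle X\rangle(\langle Y\rangle\cap Q)\subseteq Q$, and $\varphi(xy)=x\varphi(y)$ for all $x\in\langle X\rangle$ and $y\in\langle Y\rangle\cap Q$. (2) Symmetrically, suppose that $\varphi(v)=av$ for all $x\in X\setminus\{a\}$ and $v\in P_x$, and that for every $y\in Y\setminus\{a\}$ the restriction $\varphi|_{P_y}$ is right $a$-regular, i.e. $P_y$ is stable under $v\mapsto va$ and $\varphi(va)=\varphi(v)a$ for all $v\in P_y$. Then $(\langle Y\rangle\cap Q)\langle X\rangle\subseteq Q$, and $\varphi(yx)=\varphi(y)x$ for all $x\in\langle X\rangle$ and $y\in\langle Y\rangle\cap Q$. -/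

import Mathlib

namespace CoxeterSystem

variable {B W : Type*} [Group W] {M : CoxeterMatrix B}

/-- The strict Bruhat order: the transitive closure of the relation `u → u * t`, for `t` a
reflection with `ℓ u < ℓ (u * t)`. -/
def BruhatLT (cs : CoxeterSystem M W) : W → W → Prop :=
  Relation.TransGen fun u v => ∃ t, cs.IsReflection t ∧ v = u * t ∧ cs.length u < cs.length v

/-- The Bruhat order. -/
def BruhatLE (cs : CoxeterSystem M W) (u v : W) : Prop :=
  u = v ∨ cs.BruhatLT u v

/-- The covering relation of the Bruhat order. -/
def BruhatCov (cs : CoxeterSystem M W) (u v : W) : Prop :=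
  cs.BruhatLT u v ∧ ¬ ∃ z, cs.BruhatLT u z ∧ cs.BruhatLT z v

/-- The set of coatoms of `v`. -/
def coat (cs : CoxeterSystem M W) (v : W) : Set W :=
  {u | cs.BruhatCov u v}

/-- A partial special matching: a special matching of a down-closed subset `dom` of `W`,
ordered by the Bruhat order. Only the values of `map` on `dom` are meaningful. As `dom` is
down-closed, coverings and coatoms in the subposet `dom` are the same as those in `W`. -/
structure PartialMatching (cs : CoxeterSystem M W) where
  dom : Set W
  map : W → W
  dom_down_closed : ∀ q ∈ dom, ∀ x, cs.BruhatLE x q → x ∈ dom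
  map_mem : ∀ u ∈ dom, map u ∈ dom
  map_map : ∀ u ∈ dom, map (map u) = u
  cov_or_cov : ∀ u ∈ dom, cs.BruhatCov u (map u) ∨ cs.BruhatCov (map u) u
  coat_map : ∀ u ∈ dom, cs.BruhatCov u (map u) →
    cs.coat (map u) = {u} ∪ {w | ∃ v, cs.BruhatCov v u ∧ cs.BruhatCov v (map v) ∧ w = map v}

/-- `c'` extends `c`. -/
def PartialMatching.Extends {cs : CoxeterSystem M W} (c' c : cs.PartialMatching) : Prop :=
  c.dom ⊆ c'.dom ∧ ∀ u ∈ c.dom, c'.map u = c.map u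

/-- A maximal matching: a partial matching with no extension to a larger domain. -/
def PartialMatching.IsMaximal {cs : CoxeterSystem M W} (c : cs.PartialMatching) : Prop :=
  ∀ c' : cs.PartialMatching, c'.Extends c → c'.dom ⊆ c.dom

/-- The standard parabolic subgroup generated by the simple reflections with index in `X`. -/
def parabolic (cs : CoxeterSystem M W) (X : Set B) : Subgroup W :=
  Subgroup.closure (cs.simple '' X)

/-- The dihedral subgroup `⟨s, a⟩`, where `s` is the simple reflection of index `i`. -/
def dihedral (cs : CoxeterSystem M W) (a : W) (i : B) : Subgroup W :=
  Subgroup.closure {cs.simple i, a}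

end CoxeterSystem

/-- The map `φ` with domain `Q` is `s`-regular on the left. -/
def LeftRegularOn {W : Type*} [Group W] (Q : Set W) (φ : W → W) (s : W) : Prop :=
  (∀ x ∈ Q, s * x ∈ Q) ∧ ∀ x ∈ Q, φ (s * x) = s * φ x

/-- The map `φ` with domain `Q` is `s`-regular on the right. -/
def RightRegularOn {W : Type*} [Group W] (Q : Set W) (φ : W → W) (s : W) : Prop :=
  (∀ x ∈ Q, x * s ∈ Q) ∧ ∀ x ∈ Q, φ (x * s) = φ x * s

/-! Write $a=\varphi(e)$. It is enough to move one letter $s\in X\cup\{a\}$ across $\varphi$: show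
$sy\in Q$ and $\varphi(sy)=s\varphi(y)$ by induction on $\ell(y)$, for $y\in Q$ in the parabolic
subgroup generated by $X$, $Y$ and $a$. If $sy<y$ or $\varphi(y)<y$, apply induction to $sy$ or
$\varphi(y)$; if $s\varphi(y)<\varphi(y)$, lifting forces $\varphi(y)=sy$.

In the remaining case, commutation on the coatoms of $y$ shows that $s\varphi(y)$ has exactly the
coatoms required of a partner of $sy$ (`coat_simple_mul_map`). Maximality then puts $sy$ in $Q$,
since otherwise the edge $sy\lhd s\varphi(y)$ could be added (`IsMaximal.mem_dom_of_coat`). Now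
$\varphi(sy)$ and $s\varphi(y)$ have the same coatoms. Distinct elements with equal coatoms lie in a
common dihedral parabolic subgroup (`mem_dihedral_of_coat_eq`). Here that subgroup contains $s$ and,
because $a\le\varphi(y)$, also $a$, so the hypotheses on dihedral subgroups rule out a difference.
Part (2) follows by passing to inverses. -/

namespace CoxeterSystem

variable {B W : Type*} [Group W] {M : CoxeterMatrix B} (cs : CoxeterSystem M W)

/-! ### The parity cocycle of inversions and strong exchange -/

open scoped Classical in
/-- The action of a simple reflection on signed elements of `W`. -/
noncomputable def signedConj (i : B) : Function.End (W × ZMod 2) := fun p =>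
  (cs.simple i * p.1 * cs.simple i, p.2 + if p.1 = cs.simple i then 1 else 0)

open scoped Classical in
theorem signedConj_mul_pow (i j : B) (n : ℕ) (t : W) (e : ZMod 2) :
    ((cs.signedConj i * cs.signedConj j) ^ n : Function.End (W × ZMod 2)) (t, e) =
      ((cs.simple i * cs.simple j) ^ n * t * (cs.simple j * cs.simple i) ^ n,
        e + ∑ k ∈ Finset.range (2 * n),
          if t = (cs.simple j * cs.simple i) ^ k * cs.simple j then 1 else 0) := by
  induction n generalizing t e with
  | zero => simp [Function.End.one_def]
  | succ n ih =>
    have h1 : ((cs.signedConj i * cs.signedConj j) ^ (n + 1) : Function.End (W × ZMod 2)) (t, e) =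
        ((cs.signedConj i * cs.signedConj j) ^ n : Function.End (W × ZMod 2))
          (cs.simple i * (cs.simple j * t * cs.simple j) * cs.simple i,
            (e + if t = cs.simple j then 1 else 0) +
              if cs.simple j * t * cs.simple j = cs.simple i then 1 else 0) := by
      rw [pow_succ]; rfl
    have h2 : ∀ k : ℕ, (cs.simple i * (cs.simple j * t * cs.simple j) * cs.simple i =
        (cs.simple j * cs.simple i) ^ k * cs.simple j) ↔
        t = (cs.simple j * cs.simple i) ^ (k + 2) * cs.simple j := by
      intro k
      have : (cs.simple j * cs.simple i) ^ (k + 2) * cs.simple j =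
          cs.simple j * cs.simple i * ((cs.simple j * cs.simple i) ^ k * cs.simple j)
            * (cs.simple i * cs.simple j) := by
        have h3 : (cs.simple j * cs.simple i) ^ (k + 2) =
          (cs.simple j * cs.simple i) * (cs.simple j * cs.simple i) ^ k *
            (cs.simple j * cs.simple i) := by rw [pow_succ, pow_succ']
        rw [h3]; group
      rw [this]
      constructor
      · intro h
        rw [← h]
        simp [mul_assoc]
      · intro h
        rw [h]
        simp [mul_assoc]
    have h3 : (cs.simple j * t * cs.simple j = cs.simple i) ↔
        t = (cs.simple j * cs.simple i) ^ 1 * cs.simple j := by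
      constructor
      · intro h
        rw [← h]
        simp [mul_assoc]
      · intro h
        rw [h]
        simp [mul_assoc]
    rw [h1, ih]
    refine Prod.ext ?_ ?_
    · simp only
      rw [pow_succ, pow_succ']
      simp only [mul_assoc]
    · simp only [h2, h3]
      rw [show 2 * (n + 1) = 2 * n + 1 + 1 by ring, Finset.sum_range_succ', Finset.sum_range_succ']
      simp only [add_assoc, pow_zero, one_mul, zero_add, Nat.reduceAdd]
      ring

theorem signedConj_isLiftable : M.IsLiftable cs.signedConj := by
  classical
  intro i j
  funext ⟨t, e⟩
  -- Over $2m$ indices, $m$ = `M i j`, the summand has period $m$, so each contribution occurs twice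
  -- and vanishes mod 2.
  rw [signedConj_mul_pow, two_mul, Finset.sum_range_add]
  have h : (cs.simple j * cs.simple i) ^ M i j = 1 := cs.simple_mul_simple_pow' i j
  simp only [pow_add, h, one_mul, CharTwo.add_self_eq_zero, add_zero, simple_mul_simple_pow, mul_one]
  rfl

/-- The action of `W` on signed elements of `W`. -/
noncomputable def signedAction : W →* Function.End (W × ZMod 2) :=
  cs.lift ⟨cs.signedConj, cs.signedConj_isLiftable⟩

/-- The parity of the number of occurrences of `t` in the right inversion sequence of a word
for `w`. -/
noncomputable def invParity (w t : W) : ZMod 2 := (cs.signedAction w (t, 0)).2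

theorem signedAction_simple (i : B) : cs.signedAction (cs.simple i) = cs.signedConj i :=
  cs.lift_apply_simple cs.signedConj_isLiftable i

theorem signedAction_apply (w t : W) (e : ZMod 2) :
    cs.signedAction w (t, e) = (w * t * w⁻¹, e + cs.invParity w t) := by
  induction w using cs.simple_induction_left generalizing e with
  | one => simp [invParity, Function.End.one_def]
  | mul_simple_left w i ih =>
    have key : ∀ e, cs.signedAction (cs.simple i * w) (t, e) =
        cs.signedConj i (cs.signedAction w (t, e)) := by
      intro e; rw [map_mul, signedAction_simple]; rfl
    rw [invParity, key, key, ih, ih]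
    simp [signedConj, mul_assoc, add_assoc]

@[simp] theorem invParity_one (t : W) : cs.invParity 1 t = 0 := by
  simp [invParity, Function.End.one_def]

theorem invParity_mul (u w t : W) :
    cs.invParity (u * w) t = cs.invParity w t + cs.invParity u (w * t * w⁻¹) := by
  have : cs.signedAction (u * w) (t, 0) = cs.signedAction u (cs.signedAction w (t, 0)) := by
    rw [map_mul]; rfl
  rw [invParity, this, signedAction_apply, signedAction_apply, zero_add]

open scoped Classical in
theorem invParity_simple (i : B) (t : W) :
    cs.invParity (cs.simple i) t = if t = cs.simple i then 1 else 0 := by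
  rw [invParity, signedAction_simple]; simp [signedConj]

/-- For $t=usu^{-1}$ the cocycle contributions of $u$ and $u^{-1}$ cancel, leaving that of $s$ at
itself. -/
theorem IsReflection.invParity_self {t : W} (ht : cs.IsReflection t) : cs.invParity t t = 1 := by
  obtain ⟨u, i, rfl⟩ := ht
  have h1 := cs.invParity_mul u u⁻¹ (u * cs.simple i * u⁻¹)
  have h2 : u⁻¹ * (u * cs.simple i * u⁻¹) * u⁻¹⁻¹ = cs.simple i := by group
  rw [mul_inv_cancel, invParity_one, h2] at h1
  rw [invParity_mul, invParity_mul, h2, invParity_simple]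
  simp only [if_true, mul_inv_cancel_right]
  linear_combination -h1

theorem mem_rightInvSeq_of_invParity_ne_zero (ω : List B) (t : W)
    (h : cs.invParity (cs.wordProd ω) t ≠ 0) : t ∈ cs.rightInvSeq ω := by
  classical
  induction ω with
  | nil => simp at h
  | cons i ω ih =>
    rw [wordProd_cons, invParity_mul, invParity_simple] at h
    rw [rightInvSeq, List.mem_cons]
    split_ifs at h with h1
    · left
      rw [← h1]; group
    · exact Or.inr (ih (by simpa using h))

theorem invParity_eq_one_iff {t : W} (ht : cs.IsReflection t) (w : W) :
    cs.invParity w t = 1 ↔ cs.length (w * t) < cs.length w := by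
  have key : ∀ w, cs.invParity w t = 1 → cs.length (w * t) < cs.length w := by
    intro w h
    obtain ⟨ω, hω, rfl⟩ := cs.exists_isReduced w
    exact (cs.isRightInversion_of_mem_rightInvSeq hω
      (cs.mem_rightInvSeq_of_invParity_ne_zero ω t (by rw [h]; decide))).2
  refine ⟨key w, fun h => ?_⟩
  by_contra h1
  have h0 : ∀ x : ZMod 2, x ≠ 1 → 1 + x = 1 := by decide
  -- Exactly one of $w$ and $wt$ has parity 1 at $t$, so the converse is the direct implication
  -- applied to $wt$.
  have h2 : cs.invParity (w * t) t = 1 := by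
    rw [invParity_mul, ht.invParity_self, mul_inv_cancel_right, h0 _ h1]
  have h3 := key _ h2
  rw [mul_assoc, ht.mul_self, mul_one] at h3
  omega

/-- Multiplying $u$ on the left by $s$ changes the parity only at the reflection $u^{-1}su$. -/
theorem length_simple_mul_mul_lt_iff {t : W} (ht : cs.IsReflection t) (u : W) (i : B)
    (h : u * t ≠ cs.simple i * u) :
    cs.length (cs.simple i * u * t) < cs.length (cs.simple i * u) ↔
      cs.length (u * t) < cs.length u := by
  rw [← invParity_eq_one_iff cs ht, ← invParity_eq_one_iff cs ht, invParity_mul, invParity_simple,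
    if_neg, add_zero]
  intro h1
  exact h (by rw [← h1]; group)

theorem length_mul_eq_or (w : W) (i : B) : cs.length (cs.simple i * w) < cs.length w ∨
    cs.length w < cs.length (cs.simple i * w) := by
  have := cs.length_simple_mul w i
  omega

theorem mem_parabolic_of_invParity_ne_zero {X : Set B} {w : W} (hw : w ∈ cs.parabolic X) (t : W)
    (h : cs.invParity w t ≠ 0) : t ∈ cs.parabolic X := by
  classical
  induction hw using Subgroup.closure_induction generalizing t with
  | mem x hx =>
    obtain ⟨i, hi, rfl⟩ := hx
    rw [invParity_simple] at h
    by_cases h1 : t = cs.simple i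
    · rw [h1]; exact Subgroup.subset_closure ⟨i, hi, rfl⟩
    · simp [h1] at h
  | one => simp at h
  | mul x y hx hy ihx ihy =>
    rw [invParity_mul] at h
    by_cases h1 : cs.invParity y t = 0
    · rw [h1, zero_add] at h
      have hy' : y ∈ cs.parabolic X := hy
      have := (cs.parabolic X).mul_mem ((cs.parabolic X).mul_mem
        ((cs.parabolic X).inv_mem hy') (ihx _ h)) hy'
      rwa [show y⁻¹ * (y * t * y⁻¹) * y = t by group] at this
    · exact ihy _ h1
  | inv x hx ih =>
    have h1 := cs.invParity_mul x x⁻¹ t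
    rw [mul_inv_cancel, invParity_one] at h1
    have hx' : x ∈ cs.parabolic X := hx
    have h2 : cs.invParity x (x⁻¹ * t * x⁻¹⁻¹) ≠ 0 := by
      intro h3; rw [h3, add_zero] at h1; exact h h1.symm
    have := (cs.parabolic X).mul_mem ((cs.parabolic X).mul_mem hx' (ih _ h2))
        ((cs.parabolic X).inv_mem hx')
    rwa [show x * (x⁻¹ * t * x⁻¹⁻¹) * x⁻¹ = t by group] at this

/-! ### Bruhat order: lifting property and coverings -/

/-- `u → v`: `v = u * t` for a reflection `t`, and `u` is shorter than `v`. -/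
def BruhatStep (u v : W) : Prop :=
  ∃ t, cs.IsReflection t ∧ v = u * t ∧ cs.length u < cs.length v

variable {cs}

theorem BruhatStep.lt {u v : W} (h : cs.BruhatStep u v) : cs.BruhatLT u v :=
  Relation.TransGen.single h

theorem BruhatLT.length_lt {u v : W} (h : cs.BruhatLT u v) : cs.length u < cs.length v := by
  induction h with
  | single h => exact h.choose_spec.2.2
  | tail _ h ih => exact ih.trans h.choose_spec.2.2

theorem BruhatLE.length_le {u v : W} (h : cs.BruhatLE u v) : cs.length u ≤ cs.length v := by
  rcases h with rfl | h
  · exact le_rfl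
  · exact h.length_lt.le

theorem BruhatLE.refl (u : W) : cs.BruhatLE u u := Or.inl rfl

theorem BruhatLT.le {u v : W} (h : cs.BruhatLT u v) : cs.BruhatLE u v := Or.inr h

theorem BruhatLT.trans {u v w : W} (h : cs.BruhatLT u v) (h' : cs.BruhatLT v w) :
    cs.BruhatLT u w := Relation.TransGen.trans h h'

theorem BruhatLE.trans_lt {u v w : W} (h : cs.BruhatLE u v) (h' : cs.BruhatLT v w) :
    cs.BruhatLT u w := by
  rcases h with rfl | h
  exacts [h', h.trans h']

theorem BruhatLE.trans {u v w : W} (h : cs.BruhatLE u v) (h' : cs.BruhatLE v w) :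
    cs.BruhatLE u w := by
  rcases h' with rfl | h'
  exacts [h, (h.trans_lt h').le]

variable (cs)

theorem bruhatStep_simple_mul {u : W} {i : B} (h : cs.length u < cs.length (cs.simple i * u)) :
    cs.BruhatStep u (cs.simple i * u) :=
  ⟨u⁻¹ * cs.simple i * u⁻¹⁻¹, ⟨u⁻¹, i, rfl⟩, by group, h⟩

theorem bruhatStep_mul_simple {u : W} {i : B} (h : cs.length u < cs.length (u * cs.simple i)) :
    cs.BruhatStep u (u * cs.simple i) :=
  ⟨cs.simple i, cs.isReflection_simple i, rfl, h⟩

theorem bruhatStep_simple_mul_of_lt {u : W} {i : B}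
    (h : cs.length (cs.simple i * u) < cs.length u) : cs.BruhatStep (cs.simple i * u) u := by
  have := cs.bruhatStep_simple_mul (u := cs.simple i * u) (i := i) (by simpa using h)
  simpa using this

theorem bruhatStep_mul_simple_of_lt {u : W} {i : B}
    (h : cs.length (u * cs.simple i) < cs.length u) : cs.BruhatStep (u * cs.simple i) u := by
  have := cs.bruhatStep_mul_simple (u := u * cs.simple i) (i := i) (by simpa using h)
  simpa using this

variable {cs}

theorem BruhatStep.simple_mul {u v : W} (h : cs.BruhatStep u v) (i : B)
    (hne : v ≠ cs.simple i * u) : cs.BruhatStep (cs.simple i * u) (cs.simple i * v) := by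
  obtain ⟨t, ht, rfl, hl⟩ := h
  refine ⟨t, ht, by rw [mul_assoc], ?_⟩
  have h1 := cs.length_simple_mul_mul_lt_iff ht u i hne
  have h2 := ht.length_mul_left_ne (cs.simple i * u)
  rw [← mul_assoc]
  omega

/-- Half of the lifting property. -/
theorem BruhatLE.simple_mul_le {u v : W} (h : cs.BruhatLE u v) {i : B}
    (hv : cs.length (cs.simple i * v) < cs.length v) : cs.BruhatLE (cs.simple i * u) v := by
  rcases h with rfl | h
  · exact (cs.bruhatStep_simple_mul_of_lt hv).lt.le
  · induction h using Relation.TransGen.head_induction_on with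
    | single h =>
      rename_i x
      by_cases hne : v = cs.simple i * x
      · exact Or.inl hne.symm
      · exact ((BruhatStep.simple_mul h i hne).lt.trans
          (cs.bruhatStep_simple_mul_of_lt hv).lt).le
    | head h h' ih =>
      rename_i x y
      by_cases hne : y = cs.simple i * x
      · rw [← hne]; exact Or.inr h'
      · exact ((BruhatStep.simple_mul h i hne).lt.le).trans ih

/-- Half of the lifting property. -/
theorem BruhatLE.le_simple_mul {u v : W} (h : cs.BruhatLE u v) {i : B}
    (hu : cs.length u < cs.length (cs.simple i * u)) : cs.BruhatLE u (cs.simple i * v) := by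
  rcases h with rfl | h
  · exact (cs.bruhatStep_simple_mul hu).lt.le
  · induction h with
    | single h =>
      rename_i x
      by_cases hne : x = cs.simple i * u
      · rw [hne]; simp [BruhatLE.refl]
      · exact ((cs.bruhatStep_simple_mul hu).lt.trans (BruhatStep.simple_mul h i hne).lt).le
    | tail h' h ih =>
      rename_i x y
      by_cases hne : y = cs.simple i * x
      · rw [hne]; simp only [simple_mul_simple_cancel_left]; exact Or.inr h'
      · exact ih.trans (BruhatStep.simple_mul h i hne).lt.le

/-- This yields gradedness: coverings are the steps that raise length by one. Take a left descent
$s$ of $v$. If $u<su$, lifting gives $u\le sv$. Otherwise induction below $sv$ gives a coatom $x\ge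
su$ of $sv$, and either $sv$ or $sx$ serves. -/
theorem BruhatLT.exists_step {u v : W} (h : cs.BruhatLT u v) :
    ∃ x, cs.BruhatLE u x ∧ cs.BruhatStep x v ∧ cs.length v = cs.length x + 1 := by
  induction hn : cs.length v using Nat.strong_induction_on generalizing u v with
  | _ n ih =>
  subst hn
  have hv : v ≠ 1 := by
    rintro rfl
    have := h.length_lt
    simp at this
  obtain ⟨i, hi⟩ := cs.exists_leftDescent_of_ne_one hv
  have hi' := cs.isLeftDescent_iff.1 hi
  have hstep := cs.bruhatStep_simple_mul_of_lt hi
  rcases cs.length_mul_eq_or u i with hu | hu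
  · have h1 : cs.BruhatLE (cs.simple i * u) v :=
      (cs.bruhatStep_simple_mul_of_lt hu).lt.le.trans h.le
    have h2 : cs.BruhatLE (cs.simple i * u) (cs.simple i * v) :=
      h1.le_simple_mul (by simpa using hu)
    rcases h2 with h2 | h2
    · exact absurd h.length_lt (by rw [mul_left_cancel h2]; exact lt_irrefl _)
    obtain ⟨x, hx1, hx2, hx3⟩ := ih _ hi h2 rfl
    rcases cs.length_mul_eq_or x i with hx | hx
    · refine ⟨cs.simple i * v, ?_, hstep, hi'.symm⟩
      have := hx1.simple_mul_le hx
      rw [simple_mul_simple_cancel_left] at this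
      exact this.trans hx2.lt.le
    · have hx' := cs.length_simple_mul x i
      refine ⟨cs.simple i * x, ?_, ?_, by omega⟩
      · have := (hx1.trans (cs.bruhatStep_simple_mul hx).lt.le).simple_mul_le (i := i)
          (by simpa using hx)
        rwa [simple_mul_simple_cancel_left] at this
      · obtain ⟨t, ht, h3, h4⟩ := hx2
        refine ⟨t, ht, ?_, by omega⟩
        rw [mul_assoc, ← h3, simple_mul_simple_cancel_left]
  · exact ⟨_, h.le.le_simple_mul hu, hstep, hi'.symm⟩

theorem bruhatCov_iff {u v : W} :
    cs.BruhatCov u v ↔ cs.BruhatStep u v ∧ cs.length v = cs.length u + 1 := by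
  constructor
  · rintro ⟨h, hn⟩
    obtain ⟨x, h1, h2, h3⟩ := h.exists_step
    rcases h1 with rfl | h1
    · exact ⟨h2, h3⟩
    · exact absurd ⟨x, h1, h2.lt⟩ hn
  · rintro ⟨h, hl⟩
    refine ⟨h.lt, ?_⟩
    rintro ⟨z, h1, h2⟩
    have := h1.length_lt
    have := h2.length_lt
    omega

theorem BruhatCov.length_eq {u v : W} (h : cs.BruhatCov u v) : cs.length v = cs.length u + 1 :=
  (bruhatCov_iff.1 h).2

theorem BruhatCov.le {u v : W} (h : cs.BruhatCov u v) : cs.BruhatLE u v := h.1.le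

theorem BruhatCov.step {u v : W} (h : cs.BruhatCov u v) : cs.BruhatStep u v :=
  (bruhatCov_iff.1 h).1

theorem BruhatLE.eq_or_exists_cov {u v : W} (h : cs.BruhatLE u v) :
    u = v ∨ ∃ x, cs.BruhatLE u x ∧ cs.BruhatCov x v := by
  rcases h with h | h
  · exact Or.inl h
  · obtain ⟨x, h1, h2, h3⟩ := h.exists_step
    exact Or.inr ⟨x, h1, bruhatCov_iff.2 ⟨h2, h3⟩⟩

variable (cs)

theorem bruhatCov_simple_mul {u : W} {i : B} (h : cs.length u < cs.length (cs.simple i * u)) :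
    cs.BruhatCov u (cs.simple i * u) :=
  bruhatCov_iff.2 ⟨cs.bruhatStep_simple_mul h, by have := cs.length_simple_mul u i; omega⟩

theorem bruhatCov_simple_mul_of_lt {u : W} {i : B}
    (h : cs.length (cs.simple i * u) < cs.length u) : cs.BruhatCov (cs.simple i * u) u :=
  bruhatCov_iff.2 ⟨cs.bruhatStep_simple_mul_of_lt h, by have := cs.length_simple_mul u i; omega⟩

theorem bruhatCov_mul_simple_of_lt {u : W} {i : B}
    (h : cs.length (u * cs.simple i) < cs.length u) : cs.BruhatCov (u * cs.simple i) u :=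
  bruhatCov_iff.2 ⟨cs.bruhatStep_mul_simple_of_lt h, by have := cs.length_mul_simple u i; omega⟩

variable {cs}

theorem BruhatCov.eq_simple_mul {u v : W} {i : B} (h : cs.BruhatCov u v)
    (hu : cs.length u < cs.length (cs.simple i * u))
    (hv : cs.length (cs.simple i * v) < cs.length v) : v = cs.simple i * u := by
  by_contra hne
  have h1 := (h.step.simple_mul i hne).lt.length_lt
  have h2 := h.length_eq
  have := cs.length_simple_mul v i
  omega

theorem BruhatCov.simple_mul {u v : W} {i : B} (h : cs.BruhatCov u v)
    (hu : cs.length u < cs.length (cs.simple i * u))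
    (hv : cs.length v < cs.length (cs.simple i * v)) :
    cs.BruhatCov (cs.simple i * u) (cs.simple i * v) := by
  have h1 := h.length_eq
  have h2 := cs.length_simple_mul v i
  have h3 := cs.length_simple_mul u i
  obtain ⟨t, ht, h4, h5⟩ := h.step
  exact bruhatCov_iff.2 ⟨⟨t, ht, by rw [h4, mul_assoc], by omega⟩, by omega⟩

/-- The coatoms of `s * v` when `v < s * v`. -/
theorem bruhatCov_simple_mul_iff {u v : W} {i : B}
    (hv : cs.length v < cs.length (cs.simple i * v)) :
    cs.BruhatCov u (cs.simple i * v) ↔ u = v ∨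
      ∃ z, cs.BruhatCov z v ∧ cs.length z < cs.length (cs.simple i * z) ∧
        u = cs.simple i * z := by
  constructor
  · intro h
    rcases cs.length_mul_eq_or u i with hu | hu
    · right
      refine ⟨cs.simple i * u, ?_, by simpa using hu, by simp⟩
      obtain ⟨t, ht, h4, h5⟩ := h.step
      have h1 := h.length_eq
      have h2 := cs.length_simple_mul v i
      have h3 := cs.length_simple_mul u i
      refine bruhatCov_iff.2 ⟨⟨t, ht, ?_, by omega⟩, by omega⟩
      rw [mul_assoc, ← h4, simple_mul_simple_cancel_left]
    · left
      exact (mul_left_cancel (h.eq_simple_mul hu (by simpa using hv))).symm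
  · rintro (rfl | ⟨z, h1, h2, rfl⟩)
    · exact cs.bruhatCov_simple_mul hv
    · exact h1.simple_mul h2 hv

/-! ### Parabolic subgroups as down-closed sets; inversion -/

theorem BruhatStep.mem_parabolic {X : Set B} {u v : W} (h : cs.BruhatStep u v)
    (hv : v ∈ cs.parabolic X) : u ∈ cs.parabolic X := by
  obtain ⟨t, ht, rfl, hl⟩ := h
  have h1 := (cs.invParity_eq_one_iff ht (u * t)).2 (by rwa [mul_assoc, ht.mul_self, mul_one])
  have h2 := cs.mem_parabolic_of_invParity_ne_zero hv t (by rw [h1]; decide)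
  exact ((cs.parabolic X).mul_mem_cancel_right h2).1 hv

theorem BruhatLE.mem_parabolic {X : Set B} {u v : W} (h : cs.BruhatLE u v)
    (hv : v ∈ cs.parabolic X) : u ∈ cs.parabolic X := by
  rcases h with rfl | h
  · exact hv
  · induction h using Relation.TransGen.head_induction_on with
    | single h => exact BruhatStep.mem_parabolic h hv
    | head h _ ih => exact BruhatStep.mem_parabolic h ih

theorem simple_mem_parabolic {X : Set B} {i : B} (hi : i ∈ X) : cs.simple i ∈ cs.parabolic X :=
  Subgroup.subset_closure ⟨i, hi, rfl⟩

theorem parabolic_induction_left {X : Set B} {p : W → Prop} (one : p 1)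
    (mul : ∀ i ∈ X, ∀ w, p w → p (cs.simple i * w)) {w : W} (hw : w ∈ cs.parabolic X) : p w := by
  induction hw using Subgroup.closure_induction_left with
  | one => exact one
  | mul_left x hx y _ ih =>
    obtain ⟨i, hi, rfl⟩ := hx
    exact mul i hi y ih
  | inv_mul_cancel x hx y _ ih =>
    obtain ⟨i, hi, rfl⟩ := hx
    rw [inv_simple]
    exact mul i hi y ih

theorem exists_simple_eq_of_le_of_mem_parabolic {X : Set B} {i : B} {w : W}
    (hw : w ∈ cs.parabolic X) (h : cs.BruhatLE (cs.simple i) w) :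
    ∃ j ∈ X, cs.simple j = cs.simple i := by
  revert h
  refine parabolic_induction_left (p := fun w => cs.BruhatLE (cs.simple i) w →
    ∃ j ∈ X, cs.simple j = cs.simple i) ?_ ?_ hw
  · intro h
    have := h.length_le
    simp at this
  · intro j hj w ih h
    rcases cs.length_mul_eq_or (cs.simple i) j with h1 | h1
    · refine ⟨j, hj, ?_⟩
      rw [length_simple, Nat.lt_one_iff, length_eq_zero_iff] at h1
      have := congrArg (cs.simple j * ·) h1
      simpa using this.symm
    · have := h.le_simple_mul h1
      rw [simple_mul_simple_cancel_left] at this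
      exact ih this

theorem one_bruhatLE (w : W) : cs.BruhatLE 1 w := by
  induction hn : cs.length w using Nat.strong_induction_on generalizing w with
  | _ n ih =>
  subst hn
  by_cases hw : w = 1
  · exact Or.inl hw.symm
  · obtain ⟨i, hi⟩ := cs.exists_leftDescent_of_ne_one hw
    exact (ih _ hi _ rfl).trans (cs.bruhatStep_simple_mul_of_lt hi).lt.le

theorem simple_le_of_isLeftDescent {w : W} {i : B} (h : cs.IsLeftDescent w i) :
    cs.BruhatLE (cs.simple i) w := by
  have := (one_bruhatLE w).simple_mul_le h
  rwa [mul_one] at this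

theorem BruhatStep.inv {u v : W} (h : cs.BruhatStep u v) : cs.BruhatStep u⁻¹ v⁻¹ := by
  obtain ⟨t, ht, rfl, hl⟩ := h
  refine ⟨u * t * u⁻¹, ht.conj u, ?_, by rwa [length_inv, length_inv]⟩
  rw [mul_inv_rev, ht.inv]; group

theorem BruhatLT.inv {u v : W} (h : cs.BruhatLT u v) : cs.BruhatLT u⁻¹ v⁻¹ := by
  induction h with
  | single h => exact (BruhatStep.inv h).lt
  | tail _ h ih => exact ih.trans (BruhatStep.inv h).lt

theorem bruhatLE_inv {u v : W} : cs.BruhatLE u⁻¹ v⁻¹ ↔ cs.BruhatLE u v := by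
  have key : ∀ {u v : W}, cs.BruhatLE u v → cs.BruhatLE u⁻¹ v⁻¹ := fun h =>
    h.imp (congrArg _) BruhatLT.inv
  exact ⟨fun h => by simpa using key h, key⟩

theorem bruhatCov_inv {u v : W} : cs.BruhatCov u⁻¹ v⁻¹ ↔ cs.BruhatCov u v := by
  have key : ∀ {u v : W}, cs.BruhatCov u v → cs.BruhatCov u⁻¹ v⁻¹ := fun h =>
    bruhatCov_iff.2 ⟨h.step.inv, by simpa using h.length_eq⟩
  exact ⟨fun h => by simpa using key h, key⟩

/-! ### What the coatoms of an element determine -/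

/-- With a left descent $s$ of $w$ and a right descent $r$ of $sw$, the coatom $wr$ still lies above
$s$, so $s$ and the coatom $sw$ are both in the subgroup. Length 1 must be excluded, the only coatom
then being $e$. -/
theorem mem_parabolic_of_coat_subset {X : Set B} {w : W} (hw : 2 ≤ cs.length w)
    (h : ∀ v, cs.BruhatCov v w → v ∈ cs.parabolic X) : w ∈ cs.parabolic X := by
  have hw1 : w ≠ 1 := by rintro rfl; simp at hw
  obtain ⟨i, hi⟩ := cs.exists_leftDescent_of_ne_one hw1
  have hi' := cs.isLeftDescent_iff.1 hi
  have hx1 : cs.simple i * w ≠ 1 := by intro h1; rw [h1, length_one] at hi'; omega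
  obtain ⟨j, hj⟩ := cs.exists_rightDescent_of_ne_one hx1
  have hj' := cs.isRightDescent_iff.1 hj
  have h1 := cs.length_simple_mul (w * cs.simple j) i
  have h2 := cs.length_mul_simple w j
  rw [mul_assoc] at hj'
  have h3 : cs.length (w * cs.simple j) < cs.length w := by omega
  have h4 := h _ (cs.bruhatCov_mul_simple_of_lt h3)
  have h5 : cs.IsLeftDescent (w * cs.simple j) i := by
    unfold IsLeftDescent; omega
  have h6 := (simple_le_of_isLeftDescent h5).mem_parabolic h4
  have h7 := h _ (cs.bruhatCov_simple_mul_of_lt hi)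
  exact ((cs.parabolic X).mul_mem_cancel_left h6).1 h7

theorem isLeftDescent_of_isLeftDescent_mul_simple {p : W} {i r : B}
    (hr : cs.IsRightDescent p r) (hi : cs.IsLeftDescent (p * cs.simple r) i) :
    cs.IsLeftDescent p i := by
  have h1 := cs.isRightDescent_iff.1 hr
  have h2 := cs.isLeftDescent_iff.1 hi
  have h3 := cs.length_mul_simple (cs.simple i * p) r
  rw [mul_assoc] at h3
  unfold IsLeftDescent
  omega

/-- The relations reproduce themselves for the shorter pair $(ps_r,\,qs_{r'})$ with $r$ and $r'$
exchanged, which drives an induction on length. -/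
theorem mem_dihedral_of_mul_eq_mul {i j r r' : B} {p q : W} (hl : cs.length p = cs.length q)
    (hp : ∀ k, cs.IsLeftDescent p k → cs.simple k = cs.simple i)
    (hq : ∀ k, cs.IsLeftDescent q k → cs.simple k = cs.simple j)
    (h1 : p * cs.simple r = cs.simple j * q) (h2 : q * cs.simple r' = cs.simple i * p) :
    p ∈ cs.parabolic {i, j} ∧ q ∈ cs.parabolic {i, j} := by
  induction hn : cs.length p generalizing p q r r' with
  | zero =>
    rw [length_eq_zero_iff] at hn
    subst hn
    rw [length_one, eq_comm, length_eq_zero_iff] at hl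
    subst hl
    exact ⟨one_mem _, one_mem _⟩
  | succ n ih =>
    have hp1 : p ≠ 1 := by rintro rfl; simp at hn
    have hq1 : q ≠ 1 := by rintro rfl; rw [length_one] at hl; omega
    obtain ⟨k, hk⟩ := cs.exists_leftDescent_of_ne_one hp1
    obtain ⟨m, hm⟩ := cs.exists_leftDescent_of_ne_one hq1
    have hk' := cs.isLeftDescent_iff.1 hk
    have hm' := cs.isLeftDescent_iff.1 hm
    rw [hp k hk, ← h2] at hk'
    rw [hq m hm, ← h1] at hm'
    have hpr : cs.IsRightDescent p r := by unfold IsRightDescent; omega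
    have hqr : cs.IsRightDescent q r' := by unfold IsRightDescent; omega
    have := ih (p := p * cs.simple r) (q := q * cs.simple r') (r := r') (r' := r) (by omega)
      (fun k hk => hp k (isLeftDescent_of_isLeftDescent_mul_simple hpr hk))
      (fun k hk => hq k (isLeftDescent_of_isLeftDescent_mul_simple hqr hk))
      (by rw [h1, mul_assoc]) (by rw [h2, mul_assoc]) (by omega)
    rw [h1, h2] at this
    exact ⟨((cs.parabolic {i, j}).mul_mem_cancel_left (simple_mem_parabolic (by simp))).1 this.2,
      ((cs.parabolic {i, j}).mul_mem_cancel_left (simple_mem_parabolic (by simp))).1 this.1⟩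

theorem eq_of_coat_eq_of_isLeftDescent {p q : W} (h : cs.coat p = cs.coat q) {i : B}
    (hp : cs.IsLeftDescent p i) (hq : cs.IsLeftDescent q i) : p = q := by
  have h1 : cs.simple i * q ∈ cs.coat p := by
    rw [h]; exact cs.bruhatCov_simple_mul_of_lt hq
  have h2 := BruhatCov.eq_simple_mul (i := i) h1 (by simpa [IsLeftDescent] using hq) hp
  rwa [simple_mul_simple_cancel_left] at h2

/-- Two distinct elements with the same coatoms lie in a common dihedral parabolic subgroup. -/
theorem mem_dihedral_of_coat_eq {p q : W} (h : cs.coat p = cs.coat q) (hne : p ≠ q) {i j : B}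
    (hp : cs.IsLeftDescent p i) (hq : cs.IsLeftDescent q j) :
    p ∈ cs.parabolic {i, j} ∧ q ∈ cs.parabolic {i, j} := by
  -- The coatom $ps_r$ of $p$ is also one of $q$. If $s_j$ were a left descent of it, then also of
  -- $p$, forcing $p=q$; so lifting gives $q=s_jps_r$. This also makes the left descent of each
  -- element unique.
  have key : ∀ {p q : W}, cs.coat p = cs.coat q → p ≠ q → ∀ {r j : B}, cs.IsRightDescent p r →
      cs.IsLeftDescent q j → p * cs.simple r = cs.simple j * q := by
    intro p q h hne r j hr hj
    have h1 : cs.BruhatCov (p * cs.simple r) q := by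
      have : p * cs.simple r ∈ cs.coat p := cs.bruhatCov_mul_simple_of_lt hr
      rwa [h] at this
    rcases cs.length_mul_eq_or (p * cs.simple r) j with h2 | h2
    · exact absurd (eq_of_coat_eq_of_isLeftDescent h
        (isLeftDescent_of_isLeftDescent_mul_simple hr h2) hj) hne
    · rw [h1.eq_simple_mul h2 hj, simple_mul_simple_cancel_left]
  have hp1 : p ≠ 1 := by rintro rfl; exact cs.not_isLeftDescent_one _ hp
  have hq1 : q ≠ 1 := by rintro rfl; exact cs.not_isLeftDescent_one _ hq
  obtain ⟨r, hr⟩ := cs.exists_rightDescent_of_ne_one hp1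
  obtain ⟨r', hr'⟩ := cs.exists_rightDescent_of_ne_one hq1
  refine mem_dihedral_of_mul_eq_mul (r := r) (r' := r') ?_ ?_ ?_ (key h hne hr hq)
    (key h.symm hne.symm hr' hp)
  · have h1 : cs.simple i * p ∈ cs.coat p := cs.bruhatCov_simple_mul_of_lt hp
    have h2 := h1
    rw [h] at h2
    rw [BruhatCov.length_eq h1, BruhatCov.length_eq h2]
  · intro k hk
    exact mul_right_cancel ((key h.symm hne.symm hr' hk).symm.trans (key h.symm hne.symm hr' hp))
  · intro k hk
    exact mul_right_cancel ((key h hne hr hk).symm.trans (key h hne hr hq))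

theorem dihedral_eq_parabolic (i j : B) :
    cs.dihedral (cs.simple j) i = cs.parabolic {i, j} := by
  rw [dihedral, parabolic, Set.image_pair]

/-! ### Partial special matchings: first properties -/

namespace PartialMatching

variable {c : cs.PartialMatching}

theorem mem_of_cov {u v : W} (h : cs.BruhatCov u v) (hv : v ∈ c.dom) : u ∈ c.dom :=
  c.dom_down_closed v hv u h.le

theorem cov_map_iff {u v : W} (hu : u ∈ c.dom) (h : cs.BruhatCov u (c.map u)) :
    cs.BruhatCov v (c.map u) ↔
      v = u ∨ ∃ x, cs.BruhatCov x u ∧ cs.BruhatCov x (c.map x) ∧ v = c.map x := by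
  change v ∈ cs.coat (c.map u) ↔ _
  rw [c.coat_map u hu h]
  rfl

theorem cov_map_of_length_lt {u : W} (hu : u ∈ c.dom)
    (h : cs.length u < cs.length (c.map u)) : cs.BruhatCov u (c.map u) := by
  rcases c.cov_or_cov u hu with h1 | h1
  · exact h1
  · have := h1.length_eq; omega

theorem cov_map_map {u : W} (hu : u ∈ c.dom) (h : cs.BruhatCov (c.map u) u) :
    cs.BruhatCov (c.map u) (c.map (c.map u)) := by
  rwa [c.map_map u hu]

theorem exists_simple_eq_map_one (h1 : (1 : W) ∈ c.dom) : ∃ i, c.map 1 = cs.simple i := by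
  rcases c.cov_or_cov 1 h1 with h | h
  · have := h.length_eq
    rw [length_one] at this
    exact cs.length_eq_one_iff.1 this
  · have := h.length_eq
    rw [length_one] at this
    omega

/-- Take a coatom $v$ of $y$ and induct on $v$ if $\varphi$ raises it, since then
$\varphi(v)\lhd\varphi(y)$, and on $\varphi(v)$ otherwise. -/
theorem map_one_le_map {y : W} (hy : y ∈ c.dom) (h : cs.BruhatCov y (c.map y)) :
    cs.BruhatLE (c.map 1) (c.map y) := by
  induction hn : cs.length y using Nat.strong_induction_on generalizing y with
  | _ n ih =>
  subst hn
  by_cases hy1 : y = 1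
  · rw [hy1]; exact BruhatLE.refl _
  obtain ⟨i, hi⟩ := cs.exists_leftDescent_of_ne_one hy1
  have hv := cs.bruhatCov_simple_mul_of_lt hi
  have hvQ := mem_of_cov hv hy
  have hl := hv.length_eq
  rcases c.cov_or_cov _ hvQ with h1 | h1
  · exact (ih _ (by omega) hvQ h1 rfl).trans
      ((cov_map_iff hy h).2 (Or.inr ⟨_, hv, h1, rfl⟩)).le
  · have h2 := ih _ (by have := h1.length_eq; omega) (c.map_mem _ hvQ) (cov_map_map hvQ h1) rfl
    rw [c.map_map _ hvQ] at h2
    exact h2.trans (hv.le.trans h.le)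

theorem map_mem_parabolic {X : Set B} (ha : c.map 1 ∈ cs.parabolic X) {y : W} (hy : y ∈ c.dom)
    (hyX : y ∈ cs.parabolic X) : c.map y ∈ cs.parabolic X := by
  induction hn : cs.length y using Nat.strong_induction_on generalizing y with
  | _ n ih =>
  subst hn
  rcases c.cov_or_cov y hy with h | h
  · by_cases hy1 : y = 1
    · rwa [hy1]
    have hl := h.length_eq
    have hy0 : cs.length y ≠ 0 := by rwa [Ne, length_eq_zero_iff]
    refine mem_parabolic_of_coat_subset (by omega) fun v hv => ?_
    rcases (cov_map_iff hy h).1 hv with rfl | ⟨x, hx, -, rfl⟩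
    · exact hyX
    · exact ih _ (by have := hx.length_eq; omega) (mem_of_cov hx hy) (hx.le.mem_parabolic hyX) rfl
  · exact h.le.mem_parabolic hyX

/-! ### Extending a matching by one edge -/

open scoped Classical in
/-- The extension of a partial matching by a new edge `w ⊲ w'`. -/
noncomputable def extend (c : cs.PartialMatching) (w w' : W) (hw : w ∉ c.dom)
    (hcoat : ∀ v, cs.BruhatCov v w → v ∈ c.dom)
    (hcoat' : cs.coat w' =
      {w} ∪ {x | ∃ v, cs.BruhatCov v w ∧ cs.BruhatCov v (c.map v) ∧ x = c.map v}) :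
    cs.PartialMatching :=
  have hww' : cs.BruhatCov w w' := by
    change w ∈ cs.coat w'
    rw [hcoat']; exact Or.inl rfl
  have hw' : w' ∉ c.dom := fun h => hw (mem_of_cov hww' h)
  have hne : w ≠ w' := fun h => by have := hww'.length_eq; rw [h] at this; omega
  let f : W → W := fun u => if u = w then w' else if u = w' then w else c.map u
  have fw : f w = w' := if_pos rfl
  have fw' : f w' = w := by simp [f, hne.symm]
  have fu : ∀ u ∈ c.dom, f u = c.map u := fun u hu => by
    simp only [f]
    rw [if_neg (by rintro rfl; exact hw hu), if_neg (by rintro rfl; exact hw' hu)]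
  have hset : ∀ u, (∀ v, cs.BruhatCov v u → v ∈ c.dom) →
      {x | ∃ v, cs.BruhatCov v u ∧ cs.BruhatCov v (f v) ∧ x = f v} =
      {x | ∃ v, cs.BruhatCov v u ∧ cs.BruhatCov v (c.map v) ∧ x = c.map v} := fun u hu => by
    ext x
    refine exists_congr fun v => and_congr_right fun hv => ?_
    rw [fu v (hu v hv)]
  have hle : ∀ x, cs.BruhatLE x w → x = w ∨ x ∈ c.dom := fun x hx => by
    rcases hx.eq_or_exists_cov with h | ⟨v, h1, h2⟩
    · exact Or.inl h
    · exact Or.inr (c.dom_down_closed _ (hcoat v h2) _ h1)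
  { dom := insert w (insert w' c.dom)
    map := f
    dom_down_closed := by
      rintro q (rfl | rfl | hq) x hx
      · rcases hle x hx with h | h
        exacts [Or.inl h, Or.inr (Or.inr h)]
      · rcases hx.eq_or_exists_cov with h | ⟨v, h1, h2⟩
        · exact Or.inr (Or.inl h)
        · have h3 : v ∈ cs.coat q := h2
          rw [hcoat'] at h3
          rcases h3 with rfl | ⟨z, hz, -, rfl⟩
          · rcases hle x h1 with h | h
            exacts [Or.inl h, Or.inr (Or.inr h)]
          · exact Or.inr (Or.inr (c.dom_down_closed _ (c.map_mem _ (hcoat z hz)) _ h1))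
      · exact Or.inr (Or.inr (c.dom_down_closed q hq x hx))
    map_mem := by
      rintro u (rfl | rfl | hu)
      · rw [fw]; exact Or.inr (Or.inl rfl)
      · rw [fw']; exact Or.inl rfl
      · rw [fu u hu]; exact Or.inr (Or.inr (c.map_mem u hu))
    map_map := by
      rintro u (rfl | rfl | hu)
      · rw [fw, fw']
      · rw [fw', fw]
      · rw [fu u hu, fu _ (c.map_mem u hu), c.map_map u hu]
    cov_or_cov := by
      rintro u (rfl | rfl | hu)
      · rw [fw]; exact Or.inl hww'
      · rw [fw']; exact Or.inr hww'
      · rw [fu u hu]; exact c.cov_or_cov u hu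
    coat_map := by
      rintro u (rfl | rfl | hu) h
      · rw [fw, hset _ hcoat, hcoat']
      · rw [fw'] at h
        have h1 := h.length_eq
        have h2 := hww'.length_eq
        omega
      · rw [fu u hu] at h ⊢
        rw [hset u fun v hv => mem_of_cov hv hu, c.coat_map u hu h] }

theorem IsMaximal.mem_dom_of_coat (hc : c.IsMaximal) {w w' : W}
    (hcoat : ∀ v, cs.BruhatCov v w → v ∈ c.dom)
    (hcoat' : cs.coat w' =
      {w} ∪ {x | ∃ v, cs.BruhatCov v w ∧ cs.BruhatCov v (c.map v) ∧ x = c.map v}) :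
    w ∈ c.dom := by
  by_contra hw
  refine hw (hc (c.extend w w' hw hcoat hcoat') ⟨fun u hu => Or.inr (Or.inr hu), fun u hu => ?_⟩
    (Or.inl rfl))
  have hww' : cs.BruhatCov w w' := by
    change w ∈ cs.coat w'
    rw [hcoat']; exact Or.inl rfl
  simp only [extend]
  rw [if_neg (by rintro rfl; exact hw hu), if_neg (by rintro rfl; exact hw (mem_of_cov hww' hu))]

/-! ### Commutation with left multiplication -/

/-- The coatoms of `s * φ y`, provided that `φ` commutes with `s` on the coatoms of `y`. -/
theorem coat_simple_mul_map {y : W} (hy : y ∈ c.dom) {i : B}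
    (hiy : cs.length y < cs.length (cs.simple i * y))
    (hup : cs.BruhatCov y (c.map y))
    (his : cs.length (c.map y) < cs.length (cs.simple i * c.map y))
    (hcomm : ∀ v, cs.BruhatCov v y →
      cs.simple i * v ∈ c.dom ∧ c.map (cs.simple i * v) = cs.simple i * c.map v) :
    cs.coat (cs.simple i * c.map y) = {cs.simple i * y} ∪
      {x | ∃ v, cs.BruhatCov v (cs.simple i * y) ∧ cs.BruhatCov v (c.map v) ∧ x = c.map v} := by
  ext u
  change cs.BruhatCov u _ ↔ u = _ ∨ ∃ v, _
  rw [bruhatCov_simple_mul_iff his]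
  constructor
  · rintro (rfl | ⟨z, hz, hzi, rfl⟩)
    · exact Or.inr ⟨y, cs.bruhatCov_simple_mul hiy, hup, rfl⟩
    · rcases (cov_map_iff hy hup).1 hz with rfl | ⟨x, hx, hxu, rfl⟩
      · exact Or.inl rfl
      · obtain ⟨hQ, hmap⟩ := hcomm x hx
        have h1 := cs.length_simple_mul x i
        have h2 := cs.length_simple_mul (c.map x) i
        have h3 := hxu.length_eq
        -- Here $s\varphi(x)$ has length $\ell(x)+2$, too long to be a coatom of $sx$.
        have h4 : cs.BruhatCov (cs.simple i * x) (c.map (cs.simple i * x)) := by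
          rcases c.cov_or_cov _ hQ with h | h
          · exact h
          · have := h.length_eq
            rw [hmap] at this
            omega
        have h5 := h4.length_eq
        rw [hmap] at h5
        exact Or.inr ⟨cs.simple i * x, hx.simple_mul (by omega) hiy, h4, hmap.symm⟩
  · rintro (rfl | ⟨v, hv, hvu, rfl⟩)
    · exact Or.inr ⟨y, hup, hiy, rfl⟩
    · rcases (bruhatCov_simple_mul_iff hiy).1 hv with rfl | ⟨z, hz, hzi, rfl⟩
      · exact Or.inl rfl
      · obtain ⟨hQ, hmap⟩ := hcomm z hz
        have h1 := hvu.length_eq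
        rw [hmap] at h1 ⊢
        have h2 := cs.length_simple_mul z i
        have h3 := cs.length_simple_mul (c.map z) i
        have h4 := cov_map_of_length_lt (mem_of_cov hz hy) (by omega)
        have h5 := h4.length_eq
        exact Or.inr ⟨c.map z, (cov_map_iff hy hup).2 (Or.inr ⟨z, hz, h4, rfl⟩), by omega, rfl⟩

/-- Left multiplication by a letter of `X` commutes with `φ` on `⟨X ∪ Y⟩`. -/
theorem IsMaximal.simple_mul_mem_dom_and_map (hc : c.IsMaximal) {k : B}
    (hk : c.map 1 = cs.simple k) {X Y : Set B} (hXY : X ⊆ Y) (hkX : k ∈ X)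
    (hX : ∀ i ∈ X, cs.simple i ≠ cs.simple k → ∀ v ∈ cs.parabolic {i, k},
      c.map v = v * cs.simple k)
    (hY : ∀ j ∈ Y, cs.simple j ≠ cs.simple k → ∀ v ∈ cs.parabolic {j, k},
      c.map (cs.simple k * v) = cs.simple k * c.map v)
    {i : B} (hi : i ∈ X) {y : W} (hyY : y ∈ cs.parabolic Y) (hy : y ∈ c.dom) :
    cs.simple i * y ∈ c.dom ∧ c.map (cs.simple i * y) = cs.simple i * c.map y := by
  have haY : c.map 1 ∈ cs.parabolic Y := by
    rw [hk]; exact simple_mem_parabolic (hXY hkX)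
  induction hn : cs.length y using Nat.strong_induction_on generalizing y with
  | _ n ih =>
  subst hn
  rcases cs.length_mul_eq_or y i with hiy | hiy
  · have hle := (cs.bruhatCov_simple_mul_of_lt hiy).le
    have hQ := c.dom_down_closed y hy _ hle
    have := (ih _ hiy (hle.mem_parabolic hyY) hQ rfl).2
    rw [simple_mul_simple_cancel_left] at this
    rw [this, simple_mul_simple_cancel_left]
    exact ⟨hQ, rfl⟩
  rcases c.cov_or_cov y hy with hup | hdown
  swap
  · have hQ := c.map_mem y hy
    obtain ⟨h1, h2⟩ := ih _ (by have := hdown.length_eq; omega) (hdown.le.mem_parabolic hyY) hQ rfl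
    rw [c.map_map y hy] at h2
    have h3 := c.map_mem _ h1
    rw [h2] at h3
    refine ⟨h3, ?_⟩
    rw [← h2, c.map_map _ h1]
  rcases cs.length_mul_eq_or (c.map y) i with his | his
  · have h1 := hup.eq_simple_mul hiy his
    rw [← h1, c.map_map y hy]
    refine ⟨c.map_mem y hy, ?_⟩
    rw [h1, simple_mul_simple_cancel_left]
  have hcomm : ∀ v, cs.BruhatCov v y →
      cs.simple i * v ∈ c.dom ∧ c.map (cs.simple i * v) = cs.simple i * c.map v := fun v hv =>
    ih _ (by have := hv.length_eq; omega) (hv.le.mem_parabolic hyY) (mem_of_cov hv hy) rfl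
  have hcoat := coat_simple_mul_map hy hiy hup his hcomm
  have hQ : cs.simple i * y ∈ c.dom := by
    refine hc.mem_dom_of_coat (fun v hv => ?_) hcoat
    rcases (bruhatCov_simple_mul_iff hiy).1 hv with rfl | ⟨z, hz, -, rfl⟩
    exacts [hy, (hcomm z hz).1]
  refine ⟨hQ, ?_⟩
  -- If $\varphi(sy)\lhd sy$, then either $\varphi(sy)=y$, so that $s$ lowers $\varphi(y)=sy$, or
  -- $\varphi(sy)=sz$ with $z\lhd y$, whence $\varphi(y)=z<y$. Both are excluded.
  have hup' : cs.BruhatCov (cs.simple i * y) (c.map (cs.simple i * y)) := by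
    rcases c.cov_or_cov _ hQ with h | h
    · exact h
    · rcases (bruhatCov_simple_mul_iff hiy).1 h with h1 | ⟨z, hz, hzi, h1⟩
      · have h2 := c.map_map _ hQ
        rw [h1] at h2
        rw [h2] at hup
        have := hup.length_eq
        have := (cs.bruhatCov_simple_mul hiy).length_eq
        have := his
        rw [h2] at this
        simp at this
        omega
      · have h2 := c.map_map _ hQ
        rw [h1, (hcomm z hz).2] at h2
        have h3 := mul_left_cancel h2
        have h4 := c.map_map z (mem_of_cov hz hy)
        rw [h3] at h4
        have := hup.length_eq
        have := hz.length_eq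
        rw [h4] at *
        omega
  have heq : cs.coat (cs.simple i * c.map y) = cs.coat (c.map (cs.simple i * y)) := by
    rw [hcoat, c.coat_map _ hQ hup']
  by_contra hne
  have hq1 : c.map (cs.simple i * y) ≠ 1 := by
    intro h
    have := hup'.length_eq
    rw [h, length_one] at this
    omega
  obtain ⟨j, hj⟩ := cs.exists_leftDescent_of_ne_one hq1
  have hp : cs.IsLeftDescent (cs.simple i * c.map y) i := by simpa [IsLeftDescent] using his
  have hpq := mem_dihedral_of_coat_eq heq (fun h => hne h.symm) hp hj
  have hyp : cs.BruhatLE y (cs.simple i * c.map y) :=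
    hup.le.trans (cs.bruhatCov_simple_mul his).le
  have hyD : y ∈ cs.parabolic {i, j} := hyp.mem_parabolic hpq.1
  have hiyQ : cs.simple i * y ∈ cs.parabolic {i, j} := hup'.le.mem_parabolic hpq.2
  have hkp : cs.BruhatLE (cs.simple k) (cs.simple i * c.map y) := by
    rw [← hk]
    exact (map_one_le_map hy hup).trans (cs.bruhatCov_simple_mul his).le
  have hij : cs.simple j ≠ cs.simple i := by
    intro h
    refine hne (eq_of_coat_eq_of_isLeftDescent heq hp ?_).symm
    unfold IsLeftDescent at hj ⊢
    rw [h] at hj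
    exact hj
  have hjY : ∃ m ∈ Y, cs.simple m = cs.simple j := by
    refine exists_simple_eq_of_le_of_mem_parabolic ?_ (simple_le_of_isLeftDescent hj)
    refine map_mem_parabolic haY hQ ((cs.parabolic Y).mul_mem ?_ hyY)
    exact simple_mem_parabolic (hXY hi)
  obtain ⟨m, hm, hmj⟩ := hjY
  obtain ⟨l, hl, hlk⟩ := exists_simple_eq_of_le_of_mem_parabolic hpq.1 hkp
  -- The subgroup contains $a$, so $a$ is $s$ or $s_j$. If $a=s$, left regularity on $P_{s_j}$ gives
  -- the equality; if $a=s_j$, both sides are $sya$.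
  rcases hl with rfl | rfl
  · have hD : cs.parabolic {l, j} = cs.parabolic {m, k} := by
      simp only [parabolic, Set.image_pair, hlk, hmj, Set.pair_comm]
    rw [hD] at hyD
    rw [hlk] at hne hij
    exact hne (hY m hm (by rwa [hmj]) y hyD)
  · have hD : cs.parabolic {i, l} = cs.parabolic {i, k} := by
      simp only [parabolic, Set.image_pair, hlk]
    rw [hD] at hyD hiyQ
    rw [hlk] at hij
    rw [hX i hi hij.symm y hyD, hX i hi hij.symm _ hiyQ, mul_assoc] at hne
    exact hne rfl

/-- Left multiplication by `⟨X⟩` commutes with `φ` on `⟨Y⟩`, if `φ` is right multiplication by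
`a = φ(1)` on the dihedral subgroups of `X` and left `a`-regular on those of `Y`. -/
theorem IsMaximal.mul_mem_dom_and_map (hc : c.IsMaximal) (X Y : Set B)
    (hX : ∀ i ∈ X, cs.simple i ≠ c.map 1 → ∀ v ∈ cs.dihedral (c.map 1) i, c.map v = v * c.map 1)
    (hY : ∀ j ∈ Y, cs.simple j ≠ c.map 1 →
      LeftRegularOn (cs.dihedral (c.map 1) j : Set W) c.map (c.map 1))
    {x : W} (hx : x ∈ cs.parabolic X) {y : W} (hyY : y ∈ cs.parabolic Y) (hy : y ∈ c.dom) :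
    x * y ∈ c.dom ∧ c.map (x * y) = x * c.map y := by
  obtain ⟨k, hk⟩ := exists_simple_eq_map_one (c.dom_down_closed y hy 1 (one_bruhatLE y))
  rw [hk] at hX hY
  simp only [dihedral_eq_parabolic] at hX hY
  -- Adjoining $a$ to $X$ costs nothing, as the hypotheses exempt it. Letters of $X$ may join $Y$,
  -- because right multiplication by $a$ commutes with left multiplication; this keeps $xy$ in the
  -- ambient parabolic subgroup.
  have hX' : ∀ i ∈ X ∪ {k}, cs.simple i ≠ cs.simple k → ∀ v ∈ cs.parabolic {i, k},
      c.map v = v * cs.simple k := by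
    rintro i (hi | rfl) hne
    exacts [hX i hi hne, absurd rfl hne]
  have hY' : ∀ j ∈ X ∪ {k} ∪ Y, cs.simple j ≠ cs.simple k → ∀ v ∈ cs.parabolic {j, k},
      c.map (cs.simple k * v) = cs.simple k * c.map v := by
    rintro j (hj | hj) hne v hv
    · rw [hX' j hj hne v hv, hX' j hj hne _
        ((cs.parabolic {j, k}).mul_mem (simple_mem_parabolic (by simp)) hv), mul_assoc]
    · exact (hY j hj hne).2 v hv
  have hmono : ∀ {Z : Set B} {z : W}, Z ⊆ X ∪ {k} ∪ Y → z ∈ cs.parabolic Z →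
      z ∈ cs.parabolic (X ∪ {k} ∪ Y) := fun h hz =>
    Subgroup.closure_mono (Set.image_mono h) hz
  have hyZ := hmono Set.subset_union_right hyY
  suffices h : x * y ∈ cs.parabolic (X ∪ {k} ∪ Y) ∧ x * y ∈ c.dom ∧
      c.map (x * y) = x * c.map y from h.2
  refine parabolic_induction_left (p := fun x => x * y ∈ cs.parabolic (X ∪ {k} ∪ Y) ∧
    x * y ∈ c.dom ∧ c.map (x * y) = x * c.map y) (by simpa only [one_mul, hy, and_true] using hyZ) ?_ hx
  rintro i hi w ⟨h1, h2, h3⟩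
  obtain ⟨h4, h5⟩ := hc.simple_mul_mem_dom_and_map hk Set.subset_union_left (Or.inr rfl) hX' hY'
    (Or.inl hi : i ∈ X ∪ {k}) h1 h2
  rw [← mul_assoc] at h4 h5
  refine ⟨?_, h4, by rw [h5, h3, mul_assoc]⟩
  rw [mul_assoc]
  exact (cs.parabolic _).mul_mem (simple_mem_parabolic (Or.inl (Or.inl hi))) h1

/-! ### Left-right symmetry and conclusion -/

/-- The matching `w ↦ φ(w⁻¹)⁻¹`. -/
def inverse (c : cs.PartialMatching) : cs.PartialMatching where
  dom := {w | w⁻¹ ∈ c.dom}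
  map w := (c.map w⁻¹)⁻¹
  dom_down_closed q hq x hx := c.dom_down_closed _ hq _ (bruhatLE_inv.2 hx)
  map_mem u hu := by simpa using c.map_mem _ hu
  map_map u hu := by simp [c.map_map _ hu]
  cov_or_cov u hu := by
    rcases c.cov_or_cov _ hu with h | h
    · left; rw [← bruhatCov_inv]; simpa using h
    · right; rw [← bruhatCov_inv]; simpa using h
  coat_map u hu h := by
    rw [← bruhatCov_inv, inv_inv] at h
    ext v
    change cs.BruhatCov v _ ↔ v = u ∨ ∃ x, _
    rw [← bruhatCov_inv, inv_inv, cov_map_iff hu h, inv_inj]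
    refine or_congr_right ⟨?_, ?_⟩
    · rintro ⟨x, h1, h2, h3⟩
      refine ⟨x⁻¹, ?_, ?_, ?_⟩
      · rwa [← bruhatCov_inv, inv_inv]
      · rwa [← bruhatCov_inv, inv_inv, inv_inv]
      · rw [inv_inv, ← h3, inv_inv]
    · rintro ⟨x, h1, h2, h3⟩
      refine ⟨x⁻¹, bruhatCov_inv.2 h1, ?_, by rw [h3, inv_inv]⟩
      rwa [← bruhatCov_inv, inv_inv] at h2

theorem inverse_map (c : cs.PartialMatching) (w : W) : c.inverse.map w = (c.map w⁻¹)⁻¹ := rfl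

theorem mem_inverse_dom {w : W} : w ∈ c.inverse.dom ↔ w⁻¹ ∈ c.dom := Iff.rfl

theorem IsMaximal.inverse (hc : c.IsMaximal) : c.inverse.IsMaximal := by
  rintro c' ⟨h1, h2⟩ w hw
  refine hc c'.inverse ⟨fun u hu => ?_, fun u hu => ?_⟩ ?_
  · exact h1 (by rwa [mem_inverse_dom, inv_inv])
  · rw [inverse_map, h2 _ (by rwa [mem_inverse_dom, inv_inv]), inverse_map, inv_inv, inv_inv]
  · rwa [mem_inverse_dom, inv_inv]

end PartialMatching

end CoxeterSystem

open CoxeterSystem PartialMatching in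
theorem mainTheorem8 {B W : Type*} [Group W] {M : CoxeterMatrix B} (cs : CoxeterSystem M W)
    (c : cs.PartialMatching) (hc : c.IsMaximal) (a : W) (ha : a = c.map 1) (X Y : Set B) :
    ((∀ i ∈ X, cs.simple i ≠ a → ∀ v ∈ cs.dihedral a i, c.map v = v * a) →
      (∀ j ∈ Y, cs.simple j ≠ a → LeftRegularOn (cs.dihedral a j : Set W) c.map a) →
      ∀ x ∈ cs.parabolic X, ∀ y ∈ (cs.parabolic Y : Set W) ∩ c.dom,
        x * y ∈ c.dom ∧ c.map (x * y) = x * c.map y) ∧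
    ((∀ i ∈ X, cs.simple i ≠ a → ∀ v ∈ cs.dihedral a i, c.map v = a * v) →
      (∀ j ∈ Y, cs.simple j ≠ a → RightRegularOn (cs.dihedral a j : Set W) c.map a) →
      ∀ x ∈ cs.parabolic X, ∀ y ∈ (cs.parabolic Y : Set W) ∩ c.dom,
        y * x ∈ c.dom ∧ c.map (y * x) = c.map y * x) := by
  subst ha
  refine ⟨fun hX hY x hx y hy => hc.mul_mem_dom_and_map X Y hX hY hx hy.1 hy.2,
    fun hX hY x hx y hy => ?_⟩
  obtain ⟨k, hk⟩ := exists_simple_eq_map_one (c.dom_down_closed y hy.2 1 (one_bruhatLE y))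
  have hinv : (c.map 1)⁻¹ = c.map 1 := by rw [hk, inv_simple]
  have ha : c.inverse.map 1 = c.map 1 := by rw [inverse_map, inv_one, hinv]
  -- Since $a$ is an involution, the inverse matching has the same value $a$ at $e$, and left and
  -- right regularity are exchanged.
  have h := hc.inverse.mul_mem_dom_and_map X Y (x := x⁻¹) (y := y⁻¹) ?_ ?_
    ((cs.parabolic X).inv_mem hx) ((cs.parabolic Y).inv_mem hy.1)
    (by rw [mem_inverse_dom, inv_inv]; exact hy.2)
  · rw [mem_inverse_dom, inverse_map, inverse_map] at h
    simp only [mul_inv_rev, inv_inv] at h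
    refine ⟨h.1, ?_⟩
    rw [← inv_inj, h.2, mul_inv_rev]
  · intro i hi hne v hv
    rw [ha] at hne hv ⊢
    rw [inverse_map, hX i hi hne _ (inv_mem hv), mul_inv_rev, inv_inv, hinv]
  · intro j hj hne
    rw [ha] at hne ⊢
    obtain ⟨h1, h2⟩ := hY j hj hne
    have hmem : ∀ v ∈ (cs.dihedral (c.map 1) j : Set W), v⁻¹ ∈ (cs.dihedral (c.map 1) j : Set W) :=
      fun v hv => inv_mem hv
    refine ⟨fun v hv => ?_, fun v hv => ?_⟩
    · have := hmem _ (h1 _ (hmem v hv))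
      rwa [mul_inv_rev, inv_inv, hinv] at this
    · rw [inverse_map, inverse_map, mul_inv_rev, hinv, h2 _ (hmem v hv), mul_inv_rev, hinv]
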